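/- For $a>0$ let $$M(a)=\frac{4}{\pi}\int_0^{\pi/2}\frac{x^2}{x^2+\ln^2\!\left(2e^{-a}\cos x\right)}\,dx ,$$ let $\gamma=\lim_{n\to\infty}\left(\sum_{k=1}^n \frac1k-\ln n\right)$ be the Euler constant and let $\Gamma$ be the gamma function. Assume $0<a<\ln 2$. Then the integral defining $M(a)$ and the integral $\int_0^1 e^{-at}\ln\Gamma(t)\,dt$ converge absolutely, and $$M(a)=\frac{\gamma}{a}+\frac{a+\ln(1-e^{-a})-\gamma-\ln a}{1-e^{-a}}+\frac{a}{1-e^{-a}}\int_0^1 e^{-at}\ln\Gamma(t)\,dt .$$ -/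

import Mathlib

/-- The Glasser–Manna–Oloa integral
`M(a) = (4/π) ∫_0^{π/2} x² / (x² + ln²(2 e^{-a} cos x)) dx`. -/
noncomputable def glasserMannaOloaM (a : ℝ) : ℝ :=
  4 / Real.pi * ∫ x in (0 : ℝ)..(Real.pi / 2),
    x ^ 2 / (x ^ 2 + Real.log (2 * Real.exp (-a) * Real.cos x) ^ 2)

/-! With `z = e^{2ix}` one has `log (1 + z) = log (2 cos x) + i x`, so for `w = log (1 + z) - a` the
real part of `conj w / w` is one minus twice the integrand. Thus `M(a)` is `1` minus the mean of
`conj w / w` over the unit circle.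

On `|z| = r < 1` the conjugate satisfies `conj z = r² / z`, so `conj (log (1 + z))` is an integral
over `t` of rational functions of `z` with poles at `-r² t` (`conj_log_one_add_circleMap`). The mean
then follows from Cauchy's formula; as `0 < a < log 2`, the only zero `e^a - 1` of `w` lies in the
unit disc, and it is simple. Letting `r → 1` expresses `M(a)` through the integral of `logKernel`
(`glasserMannaOloaM_eq`).

That integral is a Laplace transform of `log Γ(1 + t)`: put `u = 1 - e^{-s}`, expand a geometric
series, and use the symmetry in `a` and `c` of `∬ e^{-at-cs-ts}` to recover the Weierstrass product
term by term (`mul_integral_log_Gamma_add_eq_integral_logKernel`). The functional equation of `Γ`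
finally reduces the half-line to `[0, 1]` (`integral_exp_neg_mul_log_Gamma_one_add`). -/

open MeasureTheory Filter Topology Set

/-! ### Cauchy integrals with respect to the angle -/

/-- Cauchy's integral formula on a circle about the origin, as an integral over the angle. -/
lemma integral_circleMap_mul_div_sub {f : ℂ → ℂ} {r : ℝ} {p : ℂ}
    (hf : DifferentiableOn ℂ f (Metric.closedBall 0 r)) (hp : p ∈ Metric.ball (0 : ℂ) r) :
    ∫ θ in (0 : ℝ)..2 * Real.pi,
      f (circleMap 0 r θ) * (circleMap 0 r θ / (circleMap 0 r θ - p)) = 2 * Real.pi * f p := by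
  have h := hf.circleIntegral_sub_inv_smul hp
  rw [circleIntegral] at h
  have h2 : ∀ θ : ℝ, deriv (circleMap 0 r) θ • ((circleMap 0 r θ - p)⁻¹ • f (circleMap 0 r θ))
      = Complex.I * (f (circleMap 0 r θ) * (circleMap 0 r θ / (circleMap 0 r θ - p))) := by
    intro θ
    simp only [deriv_circleMap, smul_eq_mul]
    ring
  simp only [h2, intervalIntegral.integral_const_mul] at h
  apply mul_left_cancel₀ Complex.I_ne_zero
  rw [h, smul_eq_mul]
  ring

lemma circleMap_zero_sub_ne {r : ℝ} {p : ℂ} (hp : p ∈ Metric.ball (0 : ℂ) r) (θ : ℝ) :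
    circleMap 0 r θ - p ≠ 0 :=
  sub_ne_zero.2 (circleMap_ne_mem_ball hp θ)

lemma continuous_circleMap_comp {f : ℂ → ℂ} {r : ℝ} (hr : 0 ≤ r)
    (hf : ContinuousOn f (Metric.closedBall 0 r)) :
    Continuous fun θ : ℝ => f (circleMap 0 r θ) :=
  hf.comp_continuous (continuous_circleMap 0 r) fun θ => circleMap_mem_closedBall 0 hr θ

/-- Since `dθ = dz / (i z)`, the origin is a second pole; the partial fraction `1 / (z - p) = p⁻¹ (z
/ (z - p) - z / z)` separates the two. -/
lemma integral_circleMap_div_sub {f : ℂ → ℂ} {r : ℝ} {p : ℂ}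
    (hf : DifferentiableOn ℂ f (Metric.closedBall 0 r)) (hp : p ∈ Metric.ball (0 : ℂ) r)
    (hp0 : p ≠ 0) :
    ∫ θ in (0 : ℝ)..2 * Real.pi, f (circleMap 0 r θ) / (circleMap 0 r θ - p)
      = 2 * Real.pi * ((f p - f 0) / p) := by
  have hr : 0 < r := (norm_nonneg p).trans_lt (by simpa using hp)
  have h0 : (0 : ℂ) ∈ Metric.ball (0 : ℂ) r := Metric.mem_ball_self hr
  have hc := continuous_circleMap_comp hr.le hf.continuousOn
  have hne := circleMap_zero_sub_ne hp
  have hne0 := circleMap_zero_sub_ne h0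
  have hi : ∀ q ∈ Metric.ball (0 : ℂ) r, IntervalIntegrable (fun θ : ℝ =>
      f (circleMap 0 r θ) * (circleMap 0 r θ / (circleMap 0 r θ - q))) volume 0 (2 * Real.pi) :=
    fun q hq => (hc.mul ((continuous_circleMap 0 r).div
      ((continuous_circleMap 0 r).sub continuous_const)
      (circleMap_zero_sub_ne hq))).intervalIntegrable _ _
  have e : ∀ θ : ℝ, f (circleMap 0 r θ) / (circleMap 0 r θ - p) = p⁻¹ *
      (f (circleMap 0 r θ) * (circleMap 0 r θ / (circleMap 0 r θ - p)) -
        f (circleMap 0 r θ) * (circleMap 0 r θ / (circleMap 0 r θ - 0))) := by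
    intro θ
    have := hne θ
    have h3 : circleMap 0 r θ ≠ 0 := by simpa using hne0 θ
    rw [sub_zero, div_self h3]
    field_simp
    ring
  simp only [e]
  rw [intervalIntegral.integral_const_mul, intervalIntegral.integral_sub (hi p hp) (hi 0 h0),
    integral_circleMap_mul_div_sub hf hp, integral_circleMap_mul_div_sub hf h0]
  ring

lemma integral_circleMap_div_sub_mul_sub {f : ℂ → ℂ} {r : ℝ} {p q : ℂ}
    (hf : DifferentiableOn ℂ f (Metric.closedBall 0 r)) (hp : p ∈ Metric.ball (0 : ℂ) r)
    (hq : q ∈ Metric.ball (0 : ℂ) r) (hp0 : p ≠ 0) (hq0 : q ≠ 0) (hpq : p ≠ q) :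
    ∫ θ in (0 : ℝ)..2 * Real.pi,
      f (circleMap 0 r θ) / ((circleMap 0 r θ - p) * (circleMap 0 r θ - q))
      = 2 * Real.pi * (f p / (p * (p - q)) - f q / (q * (p - q)) + f 0 / (p * q)) := by
  have hr : 0 < r := (norm_nonneg p).trans_lt (by simpa using hp)
  have hc := continuous_circleMap_comp hr.le hf.continuousOn
  have hpq' := sub_ne_zero.2 hpq
  have hi : ∀ q ∈ Metric.ball (0 : ℂ) r, IntervalIntegrable (fun θ : ℝ =>
      f (circleMap 0 r θ) / (circleMap 0 r θ - q)) volume 0 (2 * Real.pi) :=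
    fun q hq => (hc.div ((continuous_circleMap 0 r).sub continuous_const)
      (circleMap_zero_sub_ne hq)).intervalIntegrable _ _
  have e : ∀ θ : ℝ, f (circleMap 0 r θ) / ((circleMap 0 r θ - p) * (circleMap 0 r θ - q)) =
      (p - q)⁻¹ * (f (circleMap 0 r θ) / (circleMap 0 r θ - p) -
        f (circleMap 0 r θ) / (circleMap 0 r θ - q)) := by
    intro θ
    have h1 := circleMap_zero_sub_ne hp θ
    have h2 := circleMap_zero_sub_ne hq θ
    field_simp
    ring
  simp only [e]
  rw [intervalIntegral.integral_const_mul, intervalIntegral.integral_sub (hi p hp) (hi q hq),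
    integral_circleMap_div_sub hf hp hp0, integral_circleMap_div_sub hf hq hq0]
  field_simp
  ring

/-! ### The simple zero of `log (1 + z) - a` -/

/-- The quotient `(z - (e^a - 1)) / (log (1 + z) - a)`, extended across its removable
singularity. -/
noncomputable def logQuot (a : ℝ) (z : ℂ) : ℂ :=
  (dslope (fun z : ℂ => Complex.log (1 + z) - a) ((Real.exp a - 1 : ℝ) : ℂ) z)⁻¹

lemma one_add_mem_slitPlane {z : ℂ} (hz : ‖z‖ < 1) : 1 + z ∈ Complex.slitPlane :=
  Complex.mem_slitPlane_of_norm_lt_one hz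

lemma log_one_add_sub_eq_zero {a : ℝ} {z : ℂ} (hz : ‖z‖ < 1)
    (h : Complex.log (1 + z) - a = 0) : z = ((Real.exp a - 1 : ℝ) : ℂ) := by
  have h1 : (1 + z) ≠ 0 := Complex.slitPlane_ne_zero (one_add_mem_slitPlane hz)
  have h2 := Complex.exp_log h1
  rw [sub_eq_zero.1 h] at h2
  push_cast
  rw [h2]
  ring

lemma log_one_add_exp_sub_one (a : ℝ) :
    Complex.log (1 + ((Real.exp a - 1 : ℝ) : ℂ)) = a := by
  push_cast
  rw [add_sub_cancel, ← Complex.ofReal_exp, ← Complex.ofReal_log (Real.exp_pos a).le,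
    Real.log_exp]

lemma logQuot_of_ne {a : ℝ} {z : ℂ} (hz : z ≠ ((Real.exp a - 1 : ℝ) : ℂ)) :
    logQuot a z = (z - ((Real.exp a - 1 : ℝ) : ℂ)) / (Complex.log (1 + z) - a) := by
  rw [logQuot, dslope_of_ne _ hz, slope_def_module, log_one_add_exp_sub_one, sub_self, sub_zero,
    smul_eq_mul, mul_inv, inv_inv, div_eq_mul_inv]

lemma hasDerivAt_log_one_add_sub (a : ℝ) {z : ℂ} (hz : ‖z‖ < 1) :
    HasDerivAt (fun z : ℂ => Complex.log (1 + z) - a) (1 + z)⁻¹ z := by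
  simpa using (((hasDerivAt_id z).const_add 1).clog (one_add_mem_slitPlane hz)).sub_const (a : ℂ)

lemma dslope_log_one_add_exp {a : ℝ} (ha : ‖((Real.exp a - 1 : ℝ) : ℂ)‖ < 1) :
    dslope (fun z : ℂ => Complex.log (1 + z) - a) ((Real.exp a - 1 : ℝ) : ℂ)
      ((Real.exp a - 1 : ℝ) : ℂ) = ((Real.exp a : ℝ) : ℂ)⁻¹ := by
  rw [dslope_same, (hasDerivAt_log_one_add_sub a ha).deriv]
  push_cast
  ring

lemma logQuot_exp_sub_one {a : ℝ} (ha : ‖((Real.exp a - 1 : ℝ) : ℂ)‖ < 1) :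
    logQuot a ((Real.exp a - 1 : ℝ) : ℂ) = (Real.exp a : ℝ) := by
  rw [logQuot, dslope_log_one_add_exp ha, inv_inv]

/-- The divided difference is holomorphic, and it never vanishes: at `e^a - 1` it is the derivative
`e^{-a}`, and elsewhere in the disc `log (1 + z) - a` has no zero. -/
lemma differentiableOn_logQuot {a : ℝ} (ha : ‖((Real.exp a - 1 : ℝ) : ℂ)‖ < 1) :
    DifferentiableOn ℂ (logQuot a) (Metric.ball 0 1) := by
  have h : DifferentiableOn ℂ (fun z : ℂ => Complex.log (1 + z) - a) (Metric.ball 0 1) :=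
    fun z hz => (hasDerivAt_log_one_add_sub a (by simpa using hz)).differentiableAt.differentiableWithinAt
  have h2 := (Complex.differentiableOn_dslope (c := ((Real.exp a - 1 : ℝ) : ℂ))
    (Metric.isOpen_ball.mem_nhds (by simpa using ha))).2 h
  refine h2.inv fun z hz => ?_
  by_cases hz0 : z = ((Real.exp a - 1 : ℝ) : ℂ)
  · rw [hz0, dslope_log_one_add_exp ha]
    simp
  · rw [dslope_of_ne _ hz0, slope_def_module, log_one_add_exp_sub_one, sub_self, sub_zero,
      smul_eq_mul]
    exact mul_ne_zero (inv_ne_zero (sub_ne_zero.2 hz0))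
      fun h => hz0 (log_one_add_sub_eq_zero (by simpa using hz) h)

/-! ### Circular means for radius `r < 1` -/

/-- The kernel `(1 / a - 1 / (a - log (1 - u))) / u`. -/
noncomputable def logKernel (a u : ℝ) : ℝ := (1 / a - 1 / (a - Real.log (1 - u))) / u

lemma norm_exp_sub_one_lt_one {a : ℝ} (ha0 : 0 < a) (ha : a < Real.log 2) :
    ‖((Real.exp a - 1 : ℝ) : ℂ)‖ < 1 := by
  have h1 := Real.add_one_lt_exp ha0.ne'
  have h2 := Real.exp_lt_exp.2 ha
  rw [Real.exp_log two_pos] at h2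
  rw [Complex.norm_real, Real.norm_eq_abs, abs_of_pos (by linarith)]
  linarith

lemma ofReal_ne_circleMap {r p : ℝ} (hp : 0 < p) (hpr : p < r) (θ : ℝ) :
    circleMap 0 r θ ≠ (p : ℂ) :=
  circleMap_ne_mem_ball (by simpa [abs_of_pos hp] using hpr) θ

lemma norm_circleMap_zero_lt_one {r : ℝ} (hr0 : 0 ≤ r) (hr : r < 1) (θ : ℝ) :
    ‖circleMap 0 r θ‖ < 1 := by
  rw [norm_circleMap_zero, abs_of_nonneg hr0]
  exact hr

lemma differentiableOn_logQuot_closedBall {a r : ℝ} (ha0 : 0 < a) (ha : a < Real.log 2)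
    (hr : r < 1) : DifferentiableOn ℂ (logQuot a) (Metric.closedBall 0 r) :=
  (differentiableOn_logQuot (norm_exp_sub_one_lt_one ha0 ha)).mono
    (Metric.closedBall_subset_ball hr)

lemma logQuot_zero {a : ℝ} (ha0 : 0 < a) : logQuot a 0 = ((Real.exp a - 1 : ℝ) : ℂ) / a := by
  have h1 := Real.add_one_lt_exp ha0.ne'
  rw [logQuot_of_ne]
  · simp only [add_zero, Complex.log_one, zero_sub, neg_div_neg_eq]
  · intro h
    have := Complex.ofReal_eq_zero.1 h.symm
    linarith

lemma log_one_add_sub_ne_zero {a r : ℝ} (ha0 : 0 < a) (hr1 : r < 1) (hr : Real.exp a - 1 < r)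
    (θ : ℝ) : Complex.log (1 + circleMap 0 r θ) - a ≠ 0 := by
  have h1 := Real.add_one_lt_exp ha0.ne'
  intro h
  exact ofReal_ne_circleMap (by linarith) hr θ
    (log_one_add_sub_eq_zero (norm_circleMap_zero_lt_one (by linarith) hr1 θ) h)

lemma inv_log_one_add_sub {a r : ℝ} (ha0 : 0 < a) (hr : Real.exp a - 1 < r) (θ : ℝ) :
    (Complex.log (1 + circleMap 0 r θ) - a)⁻¹ =
      logQuot a (circleMap 0 r θ) / (circleMap 0 r θ - ((Real.exp a - 1 : ℝ) : ℂ)) := by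
  have h1 := Real.add_one_lt_exp ha0.ne'
  have h2 := ofReal_ne_circleMap (by linarith) hr θ
  rw [logQuot_of_ne h2, div_div, mul_comm, ← div_div, div_self (sub_ne_zero.2 h2), one_div]

lemma continuous_log_one_add_circleMap {r : ℝ} (hr0 : 0 ≤ r) (hr1 : r < 1) :
    Continuous fun θ : ℝ => Complex.log (1 + circleMap 0 r θ) :=
  (continuous_const.add (continuous_circleMap 0 r)).clog
    fun θ => one_add_mem_slitPlane (norm_circleMap_zero_lt_one hr0 hr1 θ)

lemma integral_inv_log_one_add_sub {a r : ℝ} (ha0 : 0 < a) (ha : a < Real.log 2) (hr1 : r < 1)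
    (hr : Real.exp a - 1 < r) :
    ∫ θ in (0 : ℝ)..2 * Real.pi, (Complex.log (1 + circleMap 0 r θ) - a)⁻¹ =
      2 * Real.pi * ((Real.exp a / (Real.exp a - 1) - 1 / a : ℝ) : ℂ) := by
  have h1 := Real.add_one_lt_exp ha0.ne'
  have h0 : Real.exp a - 1 ≠ 0 := by linarith
  have h0' : ((Real.exp a - 1 : ℝ) : ℂ) ≠ 0 := Complex.ofReal_ne_zero.2 h0
  simp only [inv_log_one_add_sub ha0 hr]
  rw [integral_circleMap_div_sub (differentiableOn_logQuot_closedBall ha0 ha hr1) _ h0',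
    logQuot_exp_sub_one (norm_exp_sub_one_lt_one ha0 ha), logQuot_zero ha0]
  · rw [← Complex.ofReal_div, ← Complex.ofReal_sub, ← Complex.ofReal_div]
    congr 2
    field_simp
  · rw [Metric.mem_ball, dist_zero_right, Complex.norm_real, Real.norm_eq_abs, abs_of_pos]
    · exact hr
    · linarith

/-- With `u = r² t`, there are three poles inside the circle. The one at `e^a - 1` gives the first
fraction; those at `-u` and at the origin give `1 / (u (a - log (1 - u)))` and `-1 / (a u)`, which
together are minus the kernel. -/
lemma integral_div_log_one_add_sub {a r t : ℝ} (ha0 : 0 < a) (ha : a < Real.log 2) (hr1 : r < 1)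
    (hr : Real.exp a - 1 < r) (ht : 0 < t) (ht1 : t ≤ 1) :
    ∫ θ in (0 : ℝ)..2 * Real.pi, (r : ℂ) ^ 2 / (circleMap 0 r θ + r ^ 2 * t) *
        (Complex.log (1 + circleMap 0 r θ) - a)⁻¹ =
      2 * Real.pi * ((r ^ 2 * (Real.exp a / ((Real.exp a - 1) * (Real.exp a - 1 + r ^ 2 * t))
        - logKernel a (r ^ 2 * t)) : ℝ) : ℂ) := by
  have h1 := Real.add_one_lt_exp ha0.ne'
  have h0 : 0 < Real.exp a - 1 := by linarith
  have hr0 : 0 < r := h0.trans hr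
  have hu : 0 < r ^ 2 * t := by positivity
  have hur : r ^ 2 * t < r := by nlinarith
  have h0' : ((Real.exp a - 1 : ℝ) : ℂ) ≠ 0 := Complex.ofReal_ne_zero.2 h0.ne'
  have hpr : ((Real.exp a - 1 : ℝ) : ℂ) ∈ Metric.ball (0 : ℂ) r := by
    rw [Metric.mem_ball, dist_zero_right, Complex.norm_real, Real.norm_eq_abs, abs_of_pos h0]
    exact hr
  have hqr : ((-(r ^ 2 * t) : ℝ) : ℂ) ∈ Metric.ball (0 : ℂ) r := by
    rw [Metric.mem_ball, dist_zero_right, Complex.norm_real, Real.norm_eq_abs, abs_neg,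
      abs_of_pos hu]
    exact hur
  have hpq : ((Real.exp a - 1 : ℝ) : ℂ) ≠ ((-(r ^ 2 * t) : ℝ) : ℂ) := by
    intro h
    have := Complex.ofReal_injective h
    linarith
  have hq0 : ((-(r ^ 2 * t) : ℝ) : ℂ) ≠ 0 := Complex.ofReal_ne_zero.2 (by linarith)
  have e : ∀ θ : ℝ, (r : ℂ) ^ 2 / (circleMap 0 r θ + r ^ 2 * t) *
        (Complex.log (1 + circleMap 0 r θ) - a)⁻¹ = (r : ℂ) ^ 2 *
        (logQuot a (circleMap 0 r θ) / ((circleMap 0 r θ - ((Real.exp a - 1 : ℝ) : ℂ)) *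
          (circleMap 0 r θ - ((-(r ^ 2 * t) : ℝ) : ℂ)))) := by
    intro θ
    rw [inv_log_one_add_sub ha0 hr]
    have : circleMap 0 r θ - ((-(r ^ 2 * t) : ℝ) : ℂ) = circleMap 0 r θ + r ^ 2 * t := by
      push_cast
      ring
    rw [this]
    simp only [div_eq_mul_inv, mul_inv]
    ring
  have hlog : Complex.log (1 + ((-(r ^ 2 * t) : ℝ) : ℂ)) - a
      = ((Real.log (1 - r ^ 2 * t) - a : ℝ) : ℂ) := by
    rw [Complex.ofReal_sub, Complex.ofReal_log (by nlinarith)]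
    push_cast
    ring_nf
  have hneg : Real.log (1 - r ^ 2 * t) < 0 := Real.log_neg (by linarith) (by linarith)
  have hne : Real.log (1 - r ^ 2 * t) - a ≠ 0 := by linarith
  have hne' : a - Real.log (1 - r ^ 2 * t) ≠ 0 := by linarith
  simp only [e]
  rw [intervalIntegral.integral_const_mul, integral_circleMap_div_sub_mul_sub
    (differentiableOn_logQuot_closedBall ha0 ha hr1) hpr hqr h0' hq0 hpq,
    logQuot_exp_sub_one (norm_exp_sub_one_lt_one ha0 ha), logQuot_zero ha0,
    logQuot_of_ne hpq.symm, hlog, mul_left_comm, logKernel]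
  norm_cast
  congr 2
  have hz : Real.exp a - 1 + r ^ 2 * t ≠ 0 := by linarith
  have hz2 : Real.exp a - 1 - -(r ^ 2 * t) ≠ 0 := by linarith
  rw [show (-(r ^ 2 * t) - (Real.exp a - 1)) = - (Real.exp a - 1 - -(r ^ 2 * t)) by ring]
  rw [show Real.log (1 - r ^ 2 * t) - a = -(a - Real.log (1 - r ^ 2 * t)) by ring]
  generalize a - Real.log (1 - r ^ 2 * t) = l at *
  generalize r ^ 2 * t = u at *
  generalize Real.exp a - 1 = z at *
  rw [sub_neg_eq_add] at *
  field_simp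
  ring

/-- Insert `conj z = r² / z` into `log (1 + c) = ∫ c / (1 + t c) dt` with `c = conj z`. This
replaces an antiholomorphic function by an average of functions meromorphic in `z`. -/
lemma conj_log_one_add_circleMap {r : ℝ} (hr0 : 0 < r) (hr1 : r < 1) (θ : ℝ) :
    (starRingEnd ℂ) (Complex.log (1 + circleMap 0 r θ)) =
      ∫ t in (0 : ℝ)..1, (r : ℂ) ^ 2 / (circleMap 0 r θ + r ^ 2 * t) := by
  set z := circleMap 0 r θ with hz
  have hn : ‖z‖ = r := by rw [hz, norm_circleMap_zero, abs_of_pos hr0]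
  have hz1 : ‖z‖ < 1 := by rw [hn]; exact hr1
  have hz0 : z ≠ 0 := by rw [← norm_pos_iff, hn]; exact hr0
  have hm : z * (starRingEnd ℂ) z = (r : ℂ) ^ 2 := by
    rw [Complex.mul_conj, Complex.normSq_eq_norm_sq, hn]
    push_cast
    rfl
  rw [← Complex.log_conj _ (Complex.slitPlane_arg_ne_pi (one_add_mem_slitPlane hz1)), map_add,
    map_one, Complex.log_eq_integral (one_add_mem_slitPlane (by rwa [Complex.norm_conj])),
    ← intervalIntegral.integral_const_mul]
  refine intervalIntegral.integral_congr fun t ht => ?_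
  rw [← hm, show z + z * (starRingEnd ℂ) z * (t : ℂ) = z * (1 + t • (starRingEnd ℂ) z) by
    rw [Complex.real_smul]; ring, mul_div_mul_left _ _ hz0, div_eq_mul_inv]

lemma circleMap_add_ne_zero {r t : ℝ} (hr0 : 0 < r) (hr1 : r < 1) (ht : t ∈ Icc (0 : ℝ) 1)
    (θ : ℝ) : circleMap 0 r θ + r ^ 2 * t ≠ 0 := by
  have h : ((-(r ^ 2 * t) : ℝ) : ℂ) ∈ Metric.ball (0 : ℂ) r := by
    have h0 := ht.1
    have h1 := ht.2
    rw [Metric.mem_ball, dist_zero_right, Complex.norm_real, Real.norm_eq_abs, abs_neg,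
      abs_of_nonneg (by positivity)]
    nlinarith
  have := circleMap_zero_sub_ne h θ
  push_cast at this
  rwa [sub_neg_eq_add] at this

/-- Fubini holds because the integrand is continuous on a compact rectangle; the substitution `u =
r² t` absorbs the factor `r²`. -/
lemma integral_conj_log_mul_inv {a r : ℝ} (ha0 : 0 < a) (ha : a < Real.log 2) (hr1 : r < 1)
    (hr : Real.exp a - 1 < r) :
    ∫ θ in (0 : ℝ)..2 * Real.pi, (starRingEnd ℂ) (Complex.log (1 + circleMap 0 r θ)) *
        (Complex.log (1 + circleMap 0 r θ) - a)⁻¹ =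
      2 * Real.pi * ((∫ u in (0 : ℝ)..r ^ 2, (Real.exp a / ((Real.exp a - 1) *
        (Real.exp a - 1 + u)) - logKernel a u) : ℝ) : ℂ) := by
  have h1 := Real.add_one_lt_exp ha0.ne'
  have hr0 : 0 < r := by linarith
  simp only [conj_log_one_add_circleMap hr0 hr1, ← intervalIntegral.integral_mul_const]
  rw [intervalIntegral_intervalIntegral_swap]
  · have e : ∫ t in (0 : ℝ)..1, ∫ θ in (0 : ℝ)..2 * Real.pi,
        (r : ℂ) ^ 2 / (circleMap 0 r θ + r ^ 2 * t) *
        (Complex.log (1 + circleMap 0 r θ) - a)⁻¹ = ∫ t in (0 : ℝ)..1,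
        2 * Real.pi * ((r ^ 2 * (Real.exp a / ((Real.exp a - 1) * (Real.exp a - 1 + r ^ 2 * t))
        - logKernel a (r ^ 2 * t)) : ℝ) : ℂ) := by
      refine intervalIntegral.integral_congr_ae (ae_of_all _ fun t ht => ?_)
      rw [uIoc_of_le zero_le_one] at ht
      exact integral_div_log_one_add_sub ha0 ha hr1 hr ht.1 ht.2
    rw [e, intervalIntegral.integral_const_mul, intervalIntegral.integral_ofReal,
      intervalIntegral.integral_const_mul]
    congr 2
    have := intervalIntegral.smul_integral_comp_mul_left (a := 0) (b := 1)
      (fun u => Real.exp a / ((Real.exp a - 1) * (Real.exp a - 1 + u)) - logKernel a u) (r ^ 2)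
    simpa using this
  · refine (ContinuousOn.integrableOn_compact (K := Icc 0 (2 * Real.pi) ×ˢ Icc (0 : ℝ) 1)
      (isCompact_Icc.prod isCompact_Icc) ?_).mono_set ?_
    · refine ContinuousOn.mul (ContinuousOn.div continuousOn_const ?_ ?_) ?_
      · exact (((continuous_circleMap 0 r).comp continuous_fst).add
          (continuous_const.mul (Complex.continuous_ofReal.comp continuous_snd))).continuousOn
      · exact fun x hx => circleMap_add_ne_zero hr0 hr1 hx.2 x.1
      · exact ((((continuous_log_one_add_circleMap hr0.le hr1).sub continuous_const).inv₀
          (log_one_add_sub_ne_zero ha0 hr1 hr)).comp continuous_fst).continuousOn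
    · rw [uIoc_of_le Real.two_pi_pos.le, uIoc_of_le zero_le_one]
      exact prod_mono Ioc_subset_Icc_self Ioc_subset_Icc_self

/-- The circular mean of `conj w / w` for `w = log (1 + z) - a`. -/
lemma integral_conj_div_log_one_add_sub {a r : ℝ} (ha0 : 0 < a) (ha : a < Real.log 2)
    (hr1 : r < 1) (hr : Real.exp a - 1 < r) :
    ∫ θ in (0 : ℝ)..2 * Real.pi, (starRingEnd ℂ) (Complex.log (1 + circleMap 0 r θ) - a) /
        (Complex.log (1 + circleMap 0 r θ) - a) =
      2 * Real.pi * (((∫ u in (0 : ℝ)..r ^ 2, (Real.exp a / ((Real.exp a - 1) *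
        (Real.exp a - 1 + u)) - logKernel a u)) + 1
        - a * (Real.exp a / (Real.exp a - 1)) : ℝ) : ℂ) := by
  have h1 := Real.add_one_lt_exp ha0.ne'
  have hr0 : 0 < r := by linarith
  have hc := continuous_log_one_add_circleMap hr0.le hr1
  have hci := (hc.sub continuous_const).inv₀ (log_one_add_sub_ne_zero ha0 hr1 hr)
  simp only [div_eq_mul_inv, map_sub, Complex.conj_ofReal, sub_mul]
  rw [intervalIntegral.integral_sub, intervalIntegral.integral_const_mul,
    integral_inv_log_one_add_sub ha0 ha hr1 hr]
  · have := integral_conj_log_mul_inv ha0 ha hr1 hr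
    simp only [div_eq_mul_inv] at this
    rw [this]
    push_cast
    have ha' : (a : ℂ) ≠ 0 := Complex.ofReal_ne_zero.2 ha0.ne'
    field_simp
    ring
  · exact ((Complex.continuous_conj.comp hc).mul hci).intervalIntegrable _ _
  · exact (continuous_const.mul hci).intervalIntegrable _ _

/-! ### Boundedness of the kernel and passage to the unit circle -/

lemma logKernel_eq {a u : ℝ} (ha0 : 0 < a) (hu0 : 0 < u) (hu1 : u < 1) :
    logKernel a u = -Real.log (1 - u) / (a * (a + -Real.log (1 - u)) * u) := by
  have hneg : Real.log (1 - u) < 0 := Real.log_neg (by linarith) (by linarith)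
  have h : a - Real.log (1 - u) ≠ 0 := by linarith
  rw [logKernel, ← sub_eq_add_neg]
  field_simp
  ring

/-- Put `m = -log (1 - u)`. From `m (1 - u) ≤ u` comes `m ≤ u (1 + m)`, which cancels the factor `u`
in the denominator; the quotient stays bounded although `m → ∞` as `u → 1`. -/
lemma abs_logKernel_le {a u : ℝ} (ha0 : 0 < a) (hu0 : 0 < u) (hu1 : u < 1) :
    |logKernel a u| ≤ 1 / a * (1 / a + 1) := by
  have hneg : Real.log (1 - u) < 0 := Real.log_neg (by linarith) (by linarith)
  have hl := Real.one_sub_inv_le_log_of_pos (show 0 < 1 - u by linarith)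
  have hl2 : -Real.log (1 - u) * (1 - u) ≤ u := by
    have h := mul_le_mul_of_nonneg_right hl (show 0 ≤ 1 - u by linarith)
    rw [sub_mul, inv_mul_cancel₀ (by linarith)] at h
    linarith
  rw [logKernel_eq ha0 hu0 hu1]
  have h1 : 0 < -Real.log (1 - u) := by linarith
  generalize -Real.log (1 - u) = m at *
  rw [abs_of_nonneg (by positivity), div_le_iff₀ (by positivity)]
  have e : 1 / a * (1 / a + 1) * (a * (a + m) * u) = u * (1 + m) + u * a + u * (m / a) := by
    field_simp
    ring
  rw [e]
  have : 0 ≤ u * a + u * (m / a) := by positivity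
  nlinarith

lemma measurable_logKernel (a : ℝ) : Measurable (logKernel a) := by
  unfold logKernel
  fun_prop

lemma integrableOn_logKernel {a : ℝ} (ha0 : 0 < a) : IntegrableOn (logKernel a) (Ioo 0 1) := by
  refine Measure.integrableOn_of_bounded (M := 1 / a * (1 / a + 1)) (by simp)
    (measurable_logKernel a).aestronglyMeasurable ?_
  refine (ae_restrict_iff' measurableSet_Ioo).2 (ae_of_all _ fun u hu => ?_)
  exact abs_logKernel_le ha0 hu.1 hu.2

lemma intervalIntegrable_logKernel {a : ℝ} (ha0 : 0 < a) :
    IntervalIntegrable (logKernel a) volume 0 1 := by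
  rw [intervalIntegrable_iff_integrableOn_Ioo_of_le zero_le_one]
  exact integrableOn_logKernel ha0

lemma one_add_circleMap_one_mem_slitPlane {θ : ℝ} (hθ : θ ∈ Ioo (-Real.pi) Real.pi) :
    1 + circleMap 0 1 θ ∈ Complex.slitPlane := by
  refine Or.inl ?_
  have h : -1 < Real.cos θ := by
    rw [← Real.cos_abs]
    have := Real.cos_lt_cos_of_nonneg_of_le_pi (abs_nonneg θ) le_rfl (abs_lt.2 hθ)
    rwa [Real.cos_pi] at this
  simp only [circleMap_zero, Complex.ofReal_one, one_mul, Complex.add_re, Complex.one_re,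
    Complex.exp_ofReal_mul_I_re]
  linarith

lemma log_one_add_circleMap_one_sub_ne_zero {a θ : ℝ} (ha0 : 0 < a) (ha : a < Real.log 2)
    (hθ : θ ∈ Ioo (-Real.pi) Real.pi) : Complex.log (1 + circleMap 0 1 θ) - a ≠ 0 := by
  intro h
  have h2 := Complex.exp_log
    (Complex.slitPlane_ne_zero (one_add_circleMap_one_mem_slitPlane hθ))
  rw [sub_eq_zero.1 h] at h2
  have h3 : circleMap 0 1 θ = ((Real.exp a - 1 : ℝ) : ℂ) := by
    push_cast
    rw [h2]
    ring
  have h4 := norm_exp_sub_one_lt_one ha0 ha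
  rw [← h3, norm_circleMap_zero] at h4
  simp at h4

lemma norm_conj_div_self_le_one (z : ℂ) : ‖(starRingEnd ℂ) z / z‖ ≤ 1 := by
  rw [norm_div, Complex.norm_conj]
  exact div_self_le_one _

lemma measurable_conj_div_log_one_add_sub (a r : ℝ) : Measurable fun θ : ℝ =>
    (starRingEnd ℂ) (Complex.log (1 + circleMap 0 r θ) - a) /
        (Complex.log (1 + circleMap 0 r θ) - a) := by
  have h : Measurable fun θ : ℝ => Complex.log (1 + circleMap 0 r θ) - a :=
    ((continuous_const.add (continuous_circleMap 0 r)).measurable.clog).sub_const _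
  exact (Complex.continuous_conj.measurable.comp h).div h

/-- Let `r → 1` from below. Since `|conj w / w| ≤ 1`, dominated convergence needs no estimate of the
logarithm near `z = -1`. -/
lemma integral_conj_div_log_one_add_sub_one {a : ℝ} (ha0 : 0 < a) (ha : a < Real.log 2) :
    ∫ θ in (-Real.pi)..Real.pi, (starRingEnd ℂ) (Complex.log (1 + circleMap 0 1 θ) - a) /
        (Complex.log (1 + circleMap 0 1 θ) - a) =
      2 * Real.pi * (((∫ u in (0 : ℝ)..1, (Real.exp a / ((Real.exp a - 1) *
        (Real.exp a - 1 + u)) - logKernel a u)) + 1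
        - a * (Real.exp a / (Real.exp a - 1)) : ℝ) : ℂ) := by
  have h1 := Real.add_one_lt_exp ha0.ne'
  have hz0 : Real.exp a - 1 < 1 := by
    have h2 := Real.exp_lt_exp.2 ha
    rw [Real.exp_log two_pos] at h2
    linarith
  set F : ℝ → ℝ → ℂ := fun r θ => (starRingEnd ℂ) (Complex.log (1 + circleMap 0 r θ) - a) /
        (Complex.log (1 + circleMap 0 r θ) - a) with hF
  have hev : ∀ᶠ r in 𝓝[<] (1 : ℝ), Real.exp a - 1 < r ∧ r < 1 :=
    (eventually_nhdsWithin_of_eventually_nhds (lt_mem_nhds hz0)).and self_mem_nhdsWithin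
  have hlim : Tendsto (fun r => ∫ θ in (-Real.pi)..Real.pi, F r θ) (𝓝[<] (1 : ℝ))
      (𝓝 (∫ θ in (-Real.pi)..Real.pi, F 1 θ)) := by
    refine intervalIntegral.tendsto_integral_filter_of_dominated_convergence (fun _ => 1) ?_ ?_
      intervalIntegrable_const ?_
    · exact Eventually.of_forall fun r =>
        (measurable_conj_div_log_one_add_sub a r).aestronglyMeasurable
    · exact Eventually.of_forall fun r => ae_of_all _ fun θ _ => norm_conj_div_self_le_one _
    -- On `(-π, π]` only the endpoint `π` gives `1 + z = 0`, so discarding a null set leaves points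
    -- where the logarithm is continuous in `r`.
    · have hae : ∀ᵐ θ : ℝ, θ ≠ Real.pi := by
        simp [ae_iff, measure_singleton]
      filter_upwards [hae] with θ hθ hmem
      rw [uIoc_of_le (by linarith [Real.pi_pos])] at hmem
      have hm : θ ∈ Ioo (-Real.pi) Real.pi := ⟨hmem.1, lt_of_le_of_ne hmem.2 hθ⟩
      have hc : ContinuousAt (fun r : ℝ => Complex.log (1 + circleMap 0 r θ) - a) 1 := by
        refine ContinuousAt.sub (ContinuousAt.clog ?_
          (one_add_circleMap_one_mem_slitPlane hm)) continuousAt_const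
        unfold circleMap
        fun_prop
      exact ((Complex.continuous_conj.continuousAt.comp hc).div hc
        (log_one_add_circleMap_one_sub_ne_zero ha0 ha hm)).tendsto.mono_left nhdsWithin_le_nhds
  have hii : IntervalIntegrable (fun u => Real.exp a / ((Real.exp a - 1) *
        (Real.exp a - 1 + u)) - logKernel a u) volume 0 1 := by
    refine IntervalIntegrable.sub ?_ (intervalIntegrable_logKernel ha0)
    refine ContinuousOn.intervalIntegrable fun u hu => ?_
    rw [uIcc_of_le zero_le_one] at hu
    refine ContinuousAt.continuousWithinAt (ContinuousAt.div (by fun_prop) (by fun_prop) ?_)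
    have := hu.1
    have h3 : 0 < Real.exp a - 1 := by linarith
    positivity
  have hlim2 : Tendsto (fun r : ℝ => ∫ u in (0 : ℝ)..r ^ 2, (Real.exp a / ((Real.exp a - 1) *
        (Real.exp a - 1 + u)) - logKernel a u)) (𝓝[<] (1 : ℝ))
      (𝓝 (∫ u in (0 : ℝ)..1, (Real.exp a / ((Real.exp a - 1) *
        (Real.exp a - 1 + u)) - logKernel a u))) := by
    have hcon := intervalIntegral.continuousOn_primitive_interval' hii left_mem_uIcc
    rw [uIcc_of_le zero_le_one] at hcon
    refine (hcon 1 (by simp)).tendsto.comp (tendsto_nhdsWithin_iff.2 ⟨?_, ?_⟩)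
    · have : Tendsto (fun r : ℝ => r ^ 2) (𝓝 1) (𝓝 (1 ^ 2)) := (continuous_pow 2).tendsto 1
      rw [one_pow] at this
      exact this.mono_left nhdsWithin_le_nhds
    · filter_upwards [hev] with r hr
      have : 0 < r := by linarith
      exact ⟨by positivity, by nlinarith [hr.2]⟩
  have hlim3 := ((Complex.continuous_ofReal.tendsto _).comp
    ((hlim2.add_const 1).sub_const (a * (Real.exp a / (Real.exp a - 1))))).const_mul
      (2 * Real.pi : ℂ)
  refine tendsto_nhds_unique (hlim.congr' ?_) hlim3
  filter_upwards [hev] with r hr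
  rw [Function.comp_apply, ← integral_conj_div_log_one_add_sub ha0 ha hr.2 hr.1]
  -- Periodicity moves the range from `[0, 2π]` to `[-π, π]`.
  have hper : Function.Periodic (F r) (2 * Real.pi) := by
    intro θ
    simp only [hF, periodic_circleMap 0 r θ]
  have := hper.intervalIntegral_add_eq (-Real.pi) 0
  rw [zero_add, show -Real.pi + 2 * Real.pi = Real.pi by ring] at this
  exact this

/-! ### The integral `M(a)` as a mean over the unit circle -/

/-- Half-angle factorisation `1 + e^{2ix} = 2 cos x · e^{ix}`; the range of `x` makes the modulus
positive and the argument principal. -/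
lemma log_one_add_circleMap_one {x : ℝ} (hx : x ∈ Ioo (-(Real.pi / 2)) (Real.pi / 2)) :
    Complex.log (1 + circleMap 0 1 (2 * x)) =
      Real.log (2 * Real.cos x) + x * Complex.I := by
  have hcos := Real.cos_pos_of_mem_Ioo hx
  have h : 1 + circleMap 0 1 (2 * x) = ((2 * Real.cos x : ℝ) : ℂ) * Complex.exp (x * Complex.I) := by
    rw [circleMap_zero]
    push_cast
    rw [Complex.cos, one_mul, mul_div_cancel₀ _ two_ne_zero, add_mul, ← Complex.exp_add,
      ← Complex.exp_add, add_comm]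
    congr 1
    · congr 1
      ring
    · rw [neg_mul, neg_add_cancel, Complex.exp_zero]
  rw [h, Complex.log_ofReal_mul (by positivity) (Complex.exp_ne_zero _), Complex.log_exp]
  · simp
    linarith [hx.1, Real.pi_pos]
  · simp
    linarith [hx.2, Real.pi_pos]

lemma re_conj_div_self {u x : ℝ} (h : (u : ℂ) + x * Complex.I ≠ 0) :
    ((starRingEnd ℂ) ((u : ℂ) + x * Complex.I) / ((u : ℂ) + x * Complex.I)).re =
      1 - 2 * (x ^ 2 / (x ^ 2 + u ^ 2)) := by
  have hn : Complex.normSq ((u : ℂ) + x * Complex.I) = x ^ 2 + u ^ 2 := by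
    rw [Complex.normSq_add_mul_I]
    ring
  have h0 : x ^ 2 + u ^ 2 ≠ 0 := by
    rw [← hn]
    exact fun h' => h (Complex.normSq_eq_zero.1 h')
  rw [Complex.div_re, hn]
  simp
  field_simp
  ring

/-- The integrand of `glasserMannaOloaM`. -/
noncomputable def gmoIntegrand (a x : ℝ) : ℝ :=
  x ^ 2 / (x ^ 2 + Real.log (2 * Real.exp (-a) * Real.cos x) ^ 2)

lemma measurable_gmoIntegrand (a : ℝ) : Measurable (gmoIntegrand a) := by
  unfold gmoIntegrand
  fun_prop

lemma abs_gmoIntegrand_le_one (a x : ℝ) : |gmoIntegrand a x| ≤ 1 := by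
  rw [gmoIntegrand, abs_of_nonneg (by positivity)]
  exact div_le_one_of_le₀ (by nlinarith [sq_nonneg (Real.log (2 * Real.exp (-a) * Real.cos x))])
    (by positivity)

lemma intervalIntegrable_gmoIntegrand (a b c : ℝ) :
    IntervalIntegrable (gmoIntegrand a) volume b c := by
  refine (intervalIntegrable_const (c := (1 : ℝ))).mono_fun
    (measurable_gmoIntegrand a).aestronglyMeasurable (ae_of_all _ fun x => ?_)
  simpa using abs_gmoIntegrand_le_one a x

lemma re_conj_div_log_one_add_circleMap_one {a x : ℝ} (ha0 : 0 < a) (ha : a < Real.log 2)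
    (hx : x ∈ Ioo (-(Real.pi / 2)) (Real.pi / 2)) :
    ((starRingEnd ℂ) (Complex.log (1 + circleMap 0 1 (2 * x)) - a) /
        (Complex.log (1 + circleMap 0 1 (2 * x)) - a)).re = 1 - 2 * gmoIntegrand a x := by
  have hcos := Real.cos_pos_of_mem_Ioo hx
  have hl : Real.log (2 * Real.exp (-a) * Real.cos x) = Real.log (2 * Real.cos x) - a := by
    rw [show 2 * Real.exp (-a) * Real.cos x = 2 * Real.cos x * Real.exp (-a) by ring,
      Real.log_mul (by positivity) (Real.exp_pos _).ne', Real.log_exp]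
    ring
  have hne := log_one_add_circleMap_one_sub_ne_zero (θ := 2 * x) ha0 ha
    ⟨by linarith [hx.1], by linarith [hx.2]⟩
  have e : Complex.log (1 + circleMap 0 1 (2 * x)) - a =
      ((Real.log (2 * Real.cos x) - a : ℝ) : ℂ) + x * Complex.I := by
    rw [log_one_add_circleMap_one hx]
    push_cast
    ring
  rw [e] at hne ⊢
  rw [re_conj_div_self hne, gmoIntegrand, hl]

/-- Real parts of the circular mean, the substitution `θ = 2x` and evenness give `1 - M(a)`. The
elementary part of the `u`-integral is `e^a / (e^a - 1) · (a - log (e^a - 1))`, whose `a`-term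
cancels against the one already in the mean. -/
lemma glasserMannaOloaM_eq {a : ℝ} (ha0 : 0 < a) (ha : a < Real.log 2) :
    glasserMannaOloaM a = (∫ u in (0 : ℝ)..1, logKernel a u) +
      (a + Real.log (1 - Real.exp (-a))) / (1 - Real.exp (-a)) := by
  have hpi := Real.pi_pos
  have h1 := Real.add_one_lt_exp ha0.ne'
  have hz0 : 0 < Real.exp a - 1 := by linarith
  have key := congrArg Complex.re (integral_conj_div_log_one_add_sub_one ha0 ha)
  set F : ℝ → ℂ := fun θ => (starRingEnd ℂ) (Complex.log (1 + circleMap 0 1 θ) - a) /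
        (Complex.log (1 + circleMap 0 1 θ) - a) with hF
  have hFint : IntervalIntegrable F volume (-Real.pi) Real.pi := by
    refine (intervalIntegrable_const (c := (1 : ℝ))).mono_fun
      (measurable_conj_div_log_one_add_sub a 1).aestronglyMeasurable (ae_of_all _ fun x => ?_)
    rw [norm_one]
    exact norm_conj_div_self_le_one _
  have hre : (∫ θ in (-Real.pi)..Real.pi, F θ).re = ∫ θ in (-Real.pi)..Real.pi, (F θ).re :=
    (Complex.reCLM.intervalIntegral_comp_comm hFint).symm
  have hsub : ∫ θ in (-Real.pi)..Real.pi, (F θ).re =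
      2 * ∫ x in (-(Real.pi / 2))..(Real.pi / 2), (F (2 * x)).re := by
    have := intervalIntegral.smul_integral_comp_mul_left (a := -(Real.pi / 2)) (b := Real.pi / 2)
      (fun θ => (F θ).re) 2
    rw [smul_eq_mul] at this
    rw [this]
    congr 1 <;> ring
  have hcongr : ∫ x in (-(Real.pi / 2))..(Real.pi / 2), (F (2 * x)).re =
      ∫ x in (-(Real.pi / 2))..(Real.pi / 2), (1 - 2 * gmoIntegrand a x) := by
    rw [intervalIntegral.integral_of_le (by linarith), intervalIntegral.integral_of_le (by linarith),
      integral_Ioc_eq_integral_Ioo, integral_Ioc_eq_integral_Ioo]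
    exact setIntegral_congr_fun measurableSet_Ioo
      fun x hx => re_conj_div_log_one_add_circleMap_one ha0 ha hx
  have heven : ∫ x in (-(Real.pi / 2))..(0 : ℝ), gmoIntegrand a x =
      ∫ x in (0 : ℝ)..(Real.pi / 2), gmoIntegrand a x := by
    have := intervalIntegral.integral_comp_neg (a := 0) (b := Real.pi / 2) (gmoIntegrand a)
    rw [neg_zero] at this
    rw [← this]
    simp [gmoIntegrand]
  rw [hre, hsub, hcongr, intervalIntegral.integral_sub intervalIntegrable_const
    ((intervalIntegrable_gmoIntegrand a _ _).const_mul 2), intervalIntegral.integral_const_mul,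
    ← intervalIntegral.integral_add_adjacent_intervals (intervalIntegrable_gmoIntegrand a _ 0)
    (intervalIntegrable_gmoIntegrand a 0 _), heven, intervalIntegral.integral_const] at key
  have hM : glasserMannaOloaM a =
      4 / Real.pi * ∫ x in (0 : ℝ)..(Real.pi / 2), gmoIntegrand a x := rfl
  have hcont : ∀ u ∈ uIcc (0 : ℝ) 1, HasDerivAt
      (fun u => Real.exp a / (Real.exp a - 1) * Real.log (Real.exp a - 1 + u))
      (Real.exp a / ((Real.exp a - 1) * (Real.exp a - 1 + u))) u := by
    intro u hu
    rw [uIcc_of_le zero_le_one] at hu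
    have h2 : Real.exp a - 1 + u ≠ 0 := by linarith [hu.1]
    refine ((((hasDerivAt_id u).const_add (Real.exp a - 1)).log h2).const_mul
      (Real.exp a / (Real.exp a - 1))).congr_deriv ?_
    rw [div_mul_div_comm, mul_one, id]
  have hci : IntervalIntegrable (fun u => Real.exp a / ((Real.exp a - 1) *
        (Real.exp a - 1 + u))) volume 0 1 := by
    refine ContinuousOn.intervalIntegrable fun u hu => ?_
    rw [uIcc_of_le zero_le_one] at hu
    refine ContinuousAt.continuousWithinAt (ContinuousAt.div (by fun_prop) (by fun_prop) ?_)
    have := hu.1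
    positivity
  rw [intervalIntegral.integral_sub hci (intervalIntegrable_logKernel ha0),
    intervalIntegral.integral_eq_sub_of_hasDerivAt hcont hci, add_zero, sub_add_cancel,
    Real.log_exp] at key
  have key2 := key
  rw [show (2 * Real.pi : ℂ) = ((2 * Real.pi : ℝ) : ℂ) by push_cast; ring, ← Complex.ofReal_mul,
    Complex.ofReal_re] at key2
  have hq : 1 - Real.exp (-a) = (Real.exp a - 1) / Real.exp a := by
    rw [Real.exp_neg]
    field_simp
  have hlog : Real.log (1 - Real.exp (-a)) = Real.log (Real.exp a - 1) - a := by
    rw [hq, Real.log_div hz0.ne' (Real.exp_pos a).ne', Real.log_exp]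
  rw [hM, hlog, hq]
  generalize ∫ x in (0 : ℝ)..(Real.pi / 2), gmoIntegrand a x = m at *
  generalize ∫ x in (0 : ℝ)..1, logKernel a x = k at *
  simp only [smul_eq_mul] at key2
  have hm : m = Real.pi / 4 * (1 - (Real.exp a / (Real.exp a - 1) * a -
    Real.exp a / (Real.exp a - 1) * Real.log (Real.exp a - 1) - k + 1 -
    a * (Real.exp a / (Real.exp a - 1)))) := by linarith
  rw [hm]
  have := Real.exp_pos a
  field_simp
  ring

/-! ### The Weierstrass product -/

lemma sub_log_one_add_nonneg {x : ℝ} (hx : 0 ≤ x) : 0 ≤ x - Real.log (1 + x) := by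
  have := Real.log_le_sub_one_of_pos (show 0 < 1 + x by linarith)
  linarith

lemma sub_log_one_add_le_sq {x : ℝ} (hx : 0 ≤ x) : x - Real.log (1 + x) ≤ x ^ 2 := by
  have h0 : 0 < 1 + x := by linarith
  have h := Real.one_sub_inv_le_log_of_pos h0
  have : x - x ^ 2 ≤ 1 - (1 + x)⁻¹ := by
    rw [← sub_nonneg]
    have e : 1 - (1 + x)⁻¹ - (x - x ^ 2) = x ^ 3 / (1 + x) := by
      field_simp
      ring
    rw [e]
    positivity
  linarith

/-- The Weierstrass product of the Gamma function, in logarithmic form. -/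
lemma hasSum_log_Gamma_one_add {t : ℝ} (ht : 0 < t) :
    HasSum (fun n : ℕ => t / (n + 1) - Real.log (1 + t / (n + 1)))
      (Real.log (Real.Gamma (1 + t)) + Real.eulerMascheroniConstant * t) := by
  rw [hasSum_iff_tendsto_nat_of_nonneg fun n => sub_log_one_add_nonneg (by positivity)]
  -- The partial sums are those of Euler's limit formula. `logGammaSeq` has the extra term `-log t`
  -- at index `0`; adding `log t` back turns `Γ(t)` into `Γ(1 + t)`.
  have h : ∀ n : ℕ, ∑ m ∈ Finset.range n, (t / (m + 1) - Real.log (1 + t / (m + 1))) =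
      t * (harmonic n - Real.log n) + (Real.BohrMollerup.logGammaSeq t n + Real.log t) := by
    intro n
    have h1 : ∑ m ∈ Finset.range n, (t / (m + 1) - Real.log (1 + t / (m + 1))) =
        t * (harmonic n : ℝ) + Real.log (n.factorial : ℝ) -
          ∑ m ∈ Finset.range n, Real.log (t + (m + 1 : ℕ)) := by
      induction n with
      | zero => simp
      | succ n ih =>
        have hn : (0 : ℝ) < n + 1 := by positivity
        have hf : (0 : ℝ) < n.factorial := by positivity
        rw [Finset.sum_range_succ, Finset.sum_range_succ, ih, harmonic_succ, Nat.factorial_succ]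
        push_cast
        rw [Real.log_mul hn.ne' hf.ne',
          show 1 + t / ((n : ℝ) + 1) = (t + (n + 1)) / (n + 1) by field_simp; ring,
          Real.log_div (by positivity) hn.ne']
        field_simp
        ring
    rw [h1, Real.BohrMollerup.logGammaSeq, Finset.sum_range_succ']
    simp only [Nat.cast_zero, add_zero]
    ring
  simp only [h]
  have hG : Real.log (Real.Gamma (1 + t)) + Real.eulerMascheroniConstant * t =
      t * Real.eulerMascheroniConstant + (Real.log (Real.Gamma t) + Real.log t) := by
    rw [add_comm 1 t, Real.Gamma_add_one ht.ne',
      Real.log_mul ht.ne' (Real.Gamma_pos_of_pos ht).ne']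
    ring
  rw [hG]
  exact (Real.tendsto_harmonic_sub_log.const_mul t).add
    ((Real.BohrMollerup.tendsto_log_gamma ht).add_const _)

/-! ### Laplace transforms of the individual terms -/

lemma integrableOn_exp_neg_mul {a : ℝ} (ha0 : 0 < a) :
    IntegrableOn (fun t : ℝ => Real.exp (-a * t)) (Ioi 0) :=
  integrableOn_exp_mul_Ioi (by linarith) 0

lemma integral_exp_neg_mul {a : ℝ} (ha0 : 0 < a) :
    ∫ t in Ioi (0 : ℝ), Real.exp (-a * t) = 1 / a := by
  rw [integral_exp_mul_Ioi (by linarith) 0, mul_zero, Real.exp_zero, neg_div_neg_eq]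

lemma integrableOn_exp_neg_mul_mul_pow {a : ℝ} (ha0 : 0 < a) (k : ℕ) :
    IntegrableOn (fun t : ℝ => Real.exp (-a * t) * t ^ k) (Ioi 0) := by
  have h := integrableOn_rpow_mul_exp_neg_mul_rpow (s := k) (p := 1) (b := a)
    (by linarith [(Nat.cast_nonneg k : (0 : ℝ) ≤ k)]) one_pos ha0
  refine h.congr_fun (fun t _ => ?_) measurableSet_Ioi
  simp only [Real.rpow_natCast, Real.rpow_one, mul_comm]

lemma integrableOn_exp_neg_mul_mul_of_le {a C : ℝ} (ha0 : 0 < a) (k : ℕ) {f : ℝ → ℝ}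
    (hm : AEStronglyMeasurable f (volume.restrict (Ioi 0)))
    (hf : ∀ t, 0 < t → |f t| ≤ C * t ^ k) :
    IntegrableOn (fun t : ℝ => Real.exp (-a * t) * f t) (Ioi 0) := by
  refine ((integrableOn_exp_neg_mul_mul_pow ha0 k).const_mul C).mono'
    ((by fun_prop : Measurable fun t : ℝ => Real.exp (-a * t)).aestronglyMeasurable.mul hm) ?_
  refine (ae_restrict_iff' measurableSet_Ioi).2 (ae_of_all _ fun t ht => ?_)
  rw [norm_mul, Real.norm_eq_abs, Real.norm_eq_abs, abs_of_pos (Real.exp_pos _), mul_left_comm]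
  exact mul_le_mul_of_nonneg_left (hf t ht) (Real.exp_pos _).le

lemma integrableOn_exp_neg_mul_div_add {a c : ℝ} (ha0 : 0 < a) (hc : 0 < c) :
    IntegrableOn (fun t : ℝ => Real.exp (-a * t) * (1 / (c + t))) (Ioi 0) := by
  refine integrableOn_exp_neg_mul_mul_of_le (C := 1 / c) ha0 0
    (by fun_prop : Measurable fun t : ℝ => 1 / (c + t)).aestronglyMeasurable fun t ht => ?_
  rw [abs_of_nonneg (by positivity), pow_zero, mul_one]
  exact one_div_le_one_div_of_le hc (by linarith)

/-- Both sides are iterated integrals of `e^{-at-cs-ts}`, which is dominated by the integrable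
product `e^{-at} e^{-cs}`. -/
lemma integral_exp_neg_mul_div_add_comm {a c : ℝ} (ha0 : 0 < a) (hc : 0 < c) :
    ∫ t in Ioi (0 : ℝ), Real.exp (-a * t) * (1 / (c + t)) =
      ∫ s in Ioi (0 : ℝ), Real.exp (-c * s) * (1 / (a + s)) := by
  have key : ∀ a c : ℝ, 0 < a → 0 < c → ∫ t in Ioi (0 : ℝ), Real.exp (-a * t) * (1 / (c + t)) =
      ∫ t in Ioi (0 : ℝ), ∫ s in Ioi (0 : ℝ), Real.exp (-a * t - c * s - t * s) := by
    intro a c ha0 hc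
    refine setIntegral_congr_fun measurableSet_Ioi fun t ht => ?_
    rw [← integral_exp_neg_mul (add_pos hc ht), ← integral_const_mul]
    refine integral_congr_ae (ae_of_all _ fun s => ?_)
    beta_reduce
    rw [← Real.exp_add]
    ring_nf
  rw [key a c ha0 hc, key c a hc ha0, integral_integral_swap]
  · refine integral_congr_ae (ae_of_all _ fun s => integral_congr_ae (ae_of_all _ fun t => ?_))
    simp only
    ring_nf
  · have h := (integrableOn_exp_neg_mul ha0).mul_prod (integrableOn_exp_neg_mul hc)
    refine h.mono' (by fun_prop) ?_
    rw [Measure.prod_restrict]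
    refine (ae_restrict_iff' (measurableSet_Ioi.prod measurableSet_Ioi)).2
      (ae_of_all _ fun x hx => ?_)
    have h1 : 0 < x.1 := hx.1
    have h2 : 0 < x.2 := hx.2
    rw [Function.uncurry, Real.norm_eq_abs, abs_of_pos (Real.exp_pos _), ← Real.exp_add]
    refine Real.exp_le_exp.2 ?_
    nlinarith [mul_pos h1 h2]

lemma integral_exp_neg_mul_sub_div_add {a c : ℝ} (ha0 : 0 < a) (hc : 0 < c) :
    ∫ t in Ioi (0 : ℝ), Real.exp (-a * t) * (1 / c - 1 / (c + t)) =
      1 / (a * c) - ∫ t in Ioi (0 : ℝ), Real.exp (-a * t) * (1 / (c + t)) := by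
  simp only [mul_sub]
  rw [integral_sub ((integrableOn_exp_neg_mul ha0).mul_const _)
    (integrableOn_exp_neg_mul_div_add ha0 hc), integral_mul_const, integral_exp_neg_mul ha0]
  congr 1
  field_simp

lemma integrableOn_exp_neg_mul_sub_div_add {a c : ℝ} (ha0 : 0 < a) (hc : 0 < c) :
    IntegrableOn (fun t : ℝ => Real.exp (-a * t) * (1 / c - 1 / (c + t))) (Ioi 0) := by
  simp only [mul_sub]
  exact ((integrableOn_exp_neg_mul ha0).mul_const _).sub (integrableOn_exp_neg_mul_div_add ha0 hc)

lemma integral_exp_neg_mul_sub_div_add_comm {a c : ℝ} (ha0 : 0 < a) (hc : 0 < c) :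
    ∫ t in Ioi (0 : ℝ), Real.exp (-a * t) * (1 / c - 1 / (c + t)) =
      ∫ s in Ioi (0 : ℝ), Real.exp (-c * s) * (1 / a - 1 / (a + s)) := by
  rw [integral_exp_neg_mul_sub_div_add ha0 hc, integral_exp_neg_mul_sub_div_add hc ha0,
    integral_exp_neg_mul_div_add_comm ha0 hc, mul_comm a c]

lemma abs_div_sub_log_le {c t : ℝ} (hc : 0 < c) (ht : 0 < t) :
    |t / c - Real.log (1 + t / c)| ≤ 1 / c ^ 2 * t ^ 2 := by
  have h : 0 ≤ t / c := by positivity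
  rw [abs_of_nonneg (sub_log_one_add_nonneg h)]
  refine (sub_log_one_add_le_sq h).trans (le_of_eq ?_)
  field_simp

lemma integrableOn_exp_neg_mul_sub_log {a c : ℝ} (ha0 : 0 < a) (hc : 0 < c) :
    IntegrableOn (fun t : ℝ => Real.exp (-a * t) * (t / c - Real.log (1 + t / c))) (Ioi 0) :=
  integrableOn_exp_neg_mul_mul_of_le ha0 2
    (by fun_prop : Measurable fun t : ℝ => t / c - Real.log (1 + t / c)).aestronglyMeasurable
    fun _ ht => abs_div_sub_log_le hc ht

/-- Integration by parts: `e^{-at} (t/c - log (1 + t/c))` vanishes at `0` and at infinity, so its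
derivative has integral zero. -/
lemma mul_integral_exp_neg_mul_sub_log {a c : ℝ} (ha0 : 0 < a) (hc : 0 < c) :
    a * ∫ t in Ioi (0 : ℝ), Real.exp (-a * t) * (t / c - Real.log (1 + t / c)) =
      ∫ t in Ioi (0 : ℝ), Real.exp (-a * t) * (1 / c - 1 / (c + t)) := by
  have hd : ∀ t ∈ Ici (0 : ℝ), HasDerivAt
      (fun t => Real.exp (-a * t) * (t / c - Real.log (1 + t / c)))
      (Real.exp (-a * t) * (1 / c - 1 / (c + t)) -
        a * (Real.exp (-a * t) * (t / c - Real.log (1 + t / c)))) t := by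
    intro t ht
    have ht' : 0 ≤ t := ht
    have h0 : 1 + t / c ≠ 0 := by positivity
    have h1 : c + t ≠ 0 := by positivity
    have h2 := ((hasDerivAt_id t).const_mul (-a)).exp
    have h3 := (hasDerivAt_id t).div_const c
    refine (h2.mul (h3.sub ((h3.const_add 1).log h0))).congr_deriv ?_
    simp only [id, Pi.sub_apply]
    have : 1 / c / (1 + t / c) = 1 / (c + t) := by field_simp
    rw [this]
    ring
  have hi := (integrableOn_exp_neg_mul_sub_div_add ha0 hc).sub
    ((integrableOn_exp_neg_mul_sub_log ha0 hc).const_mul a)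
  have hlim : Tendsto (fun t => Real.exp (-a * t) * (t / c - Real.log (1 + t / c))) atTop
      (𝓝 0) := by
    have h : Tendsto (fun t : ℝ => 1 / c ^ 2 * (t ^ (2 : ℝ) * Real.exp (-a * t))) atTop (𝓝 0) := by
      have h := (tendsto_rpow_mul_exp_neg_mul_atTop_nhds_zero 2 a ha0).const_mul (1 / c ^ 2)
      rwa [mul_zero] at h
    refine squeeze_zero_norm' ?_ h
    filter_upwards [eventually_gt_atTop 0] with t ht
    rw [norm_mul, Real.norm_eq_abs, Real.norm_eq_abs, abs_of_pos (Real.exp_pos _),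
      Real.rpow_two, mul_comm (t ^ 2), mul_left_comm]
    exact mul_le_mul_of_nonneg_left (abs_div_sub_log_le hc ht) (Real.exp_pos _).le
  have h := integral_Ioi_of_hasDerivAt_of_tendsto' hd hi hlim
  rw [integral_sub (integrableOn_exp_neg_mul_sub_div_add ha0 hc)
    ((integrableOn_exp_neg_mul_sub_log ha0 hc).const_mul a), integral_const_mul] at h
  simp at h
  simp
  linarith

/-! ### The kernel integral as a Laplace transform of `log Γ(1 + t)` -/

/-- Substitute `u = 1 - e^{-s}`, which turns `-log (1 - u)` into `s`. -/
lemma integral_logKernel {a : ℝ} :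
    ∫ u in (0 : ℝ)..1, logKernel a u = ∫ s in Ioi (0 : ℝ),
      Real.exp (-s) * ((1 / a - 1 / (a + s)) / (1 - Real.exp (-s))) := by
  have himage : (fun s : ℝ => 1 - Real.exp (-s)) '' Ioi 0 = Ioo 0 1 := by
    ext u
    constructor
    · rintro ⟨s, hs, rfl⟩
      have h1 : Real.exp (-s) < 1 := Real.exp_lt_one_iff.2 (neg_lt_zero.2 hs)
      have h2 := Real.exp_pos (-s)
      exact ⟨by linarith, by linarith⟩
    · rintro ⟨h0, h1⟩
      refine ⟨-Real.log (1 - u), neg_pos.2 (Real.log_neg (by linarith) (by linarith)), ?_⟩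
      simp only [neg_neg]
      rw [Real.exp_log (by linarith)]
      ring
  have hd : ∀ s ∈ Ioi (0 : ℝ), HasDerivWithinAt (fun s : ℝ => 1 - Real.exp (-s))
      (Real.exp (-s)) (Ioi 0) s := by
    intro s _
    refine HasDerivAt.hasDerivWithinAt ?_
    simpa using ((hasDerivAt_id s).neg.exp).const_sub 1
  have hinj : InjOn (fun s : ℝ => 1 - Real.exp (-s)) (Ioi 0) := by
    intro x _ y _ h
    have : Real.exp (-x) = Real.exp (-y) := by
      simp only at h
      linarith
    exact neg_injective (Real.exp_injective this)
  rw [intervalIntegral.integral_of_le zero_le_one, integral_Ioc_eq_integral_Ioo, ← himage,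
    integral_image_eq_integral_abs_deriv_smul measurableSet_Ioi hd hinj]
  refine integral_congr_ae (ae_of_all _ fun s => ?_)
  simp only [logKernel, smul_eq_mul, abs_of_pos (Real.exp_pos _), sub_sub_cancel, Real.log_exp,
    sub_neg_eq_add]

lemma hasSum_exp_neg_mul {s : ℝ} (hs : 0 < s) (x : ℝ) :
    HasSum (fun n : ℕ => Real.exp (-(n + 1 : ℝ) * s) * x)
      (Real.exp (-s) * (x / (1 - Real.exp (-s)))) := by
  have h := ((hasSum_geometric_of_lt_one (Real.exp_pos (-s)).le
    (Real.exp_lt_one_iff.2 (neg_lt_zero.2 hs))).mul_left (Real.exp (-s))).mul_right x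
  rw [mul_assoc, inv_mul_eq_div] at h
  have e : ∀ n : ℕ, Real.exp (-(n + 1 : ℝ) * s) * x = Real.exp (-s) * Real.exp (-s) ^ n * x := by
    intro n
    rw [← Real.exp_nat_mul, ← Real.exp_add]
    ring_nf
  simpa only [e] using h

lemma continuousOn_Gamma_one_add : ContinuousOn (fun t : ℝ => Real.log (Real.Gamma (1 + t)))
    (Ici 0) := by
  intro t ht
  have ht' : 0 ≤ t := ht
  refine ContinuousAt.continuousWithinAt (ContinuousAt.log ?_
    (Real.Gamma_pos_of_pos (by linarith)).ne')
  refine ContinuousAt.comp (f := fun t : ℝ => 1 + t) (g := Real.Gamma) ?_ (by fun_prop)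
  refine (Real.differentiableAt_Gamma fun m => ?_).continuousAt
  have : (0 : ℝ) ≤ m := Nat.cast_nonneg m
  linarith

lemma summable_one_div_succ_sq : Summable fun n : ℕ => 1 / ((n : ℝ) + 1) ^ 2 := by
  have := (summable_nat_add_iff 1).2 (Real.summable_one_div_nat_pow.2 one_lt_two)
  simpa using this

/-- Summing the quadratic bounds on the terms of the Weierstrass series gives growth at most a
constant times `t²`. -/
lemma integrableOn_exp_neg_mul_log_Gamma_add {a : ℝ} (ha0 : 0 < a) :
    IntegrableOn (fun t : ℝ => Real.exp (-a * t) *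
      (Real.log (Real.Gamma (1 + t)) + Real.eulerMascheroniConstant * t)) (Ioi 0) := by
  refine integrableOn_exp_neg_mul_mul_of_le (C := ∑' n : ℕ, 1 / ((n : ℝ) + 1) ^ 2) ha0 2 ?_ ?_
  · exact ((continuousOn_Gamma_one_add.mono Ioi_subset_Ici_self).add
      (by fun_prop)).aestronglyMeasurable measurableSet_Ioi
  · intro t ht
    have h := hasSum_log_Gamma_one_add ht
    have hb : ∀ n : ℕ, |t / ((n : ℝ) + 1) - Real.log (1 + t / (n + 1))| ≤
        1 / ((n : ℝ) + 1) ^ 2 * t ^ 2 := fun n => abs_div_sub_log_le (by positivity) ht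
    rw [← h.tsum_eq, ← tsum_mul_right]
    exact tsum_of_norm_bounded (f := fun n : ℕ => t / ((n : ℝ) + 1) - Real.log (1 + t / (n + 1)))
      (summable_one_div_succ_sq.mul_right _).hasSum hb

lemma integrableOn_exp_neg_mul_log_Gamma_one_add {a : ℝ} (ha0 : 0 < a) :
    IntegrableOn (fun t : ℝ => Real.exp (-a * t) * Real.log (Real.Gamma (1 + t))) (Ioi 0) := by
  have h := (integrableOn_exp_neg_mul_log_Gamma_add ha0).sub
    ((integrableOn_exp_neg_mul_mul_pow ha0 1).const_mul Real.eulerMascheroniConstant)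
  refine h.congr_fun (fun t _ => ?_) measurableSet_Ioi
  simp only [Pi.sub_apply]
  ring

lemma integral_exp_neg_mul_mul_self {a : ℝ} (ha0 : 0 < a) :
    ∫ t in Ioi (0 : ℝ), Real.exp (-a * t) * t = 1 / a ^ 2 := by
  have h := Real.integral_rpow_mul_exp_neg_mul_Ioi two_pos ha0
  rw [Real.Gamma_two, mul_one, Real.rpow_two, div_pow, one_pow] at h
  rw [← h]
  refine setIntegral_congr_fun measurableSet_Ioi fun t _ => ?_
  rw [show (2 : ℝ) - 1 = 1 by norm_num, Real.rpow_one, neg_mul, mul_comm]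

/-- The Weierstrass series on one side and the geometric series of `e^{-s} / (1 - e^{-s})` on the
other have equal integrals term by term, by integration by parts and the symmetry with `c = n + 1`.
-/
lemma mul_integral_log_Gamma_add_eq_integral_logKernel {a : ℝ} (ha0 : 0 < a) :
    a * ∫ t in Ioi (0 : ℝ), Real.exp (-a * t) *
      (Real.log (Real.Gamma (1 + t)) + Real.eulerMascheroniConstant * t) =
      ∫ u in (0 : ℝ)..1, logKernel a u := by
  have hc : ∀ n : ℕ, (0 : ℝ) < n + 1 := fun n => by positivity
  have hI : ∀ n : ℕ, ∫ t in Ioi (0 : ℝ), ‖Real.exp (-a * t) *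
      (t / (n + 1) - Real.log (1 + t / (n + 1)))‖ =
      ∫ t in Ioi (0 : ℝ), Real.exp (-a * t) * (t / (n + 1) - Real.log (1 + t / (n + 1))) :=
    fun n => setIntegral_congr_fun measurableSet_Ioi fun t ht => Real.norm_of_nonneg
      (mul_nonneg (Real.exp_pos _).le (sub_log_one_add_nonneg (div_nonneg (le_of_lt ht) (hc n).le)))
  have hJ : ∀ n : ℕ, ∫ s in Ioi (0 : ℝ), ‖Real.exp (-(n + 1 : ℝ) * s) * (1 / a - 1 / (a + s))‖ =
      ∫ s in Ioi (0 : ℝ), Real.exp (-(n + 1 : ℝ) * s) * (1 / a - 1 / (a + s)) :=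
    fun n => setIntegral_congr_fun measurableSet_Ioi fun s hs => Real.norm_of_nonneg
      (mul_nonneg (Real.exp_pos _).le (sub_nonneg.2 (one_div_le_one_div_of_le ha0
        (by linarith [mem_Ioi.1 hs]))))
  have hs1 : Summable fun n : ℕ => ∫ t in Ioi (0 : ℝ), ‖Real.exp (-a * t) *
      (t / (n + 1) - Real.log (1 + t / (n + 1)))‖ := by
    refine Summable.of_nonneg_of_le (fun n => integral_nonneg fun t => norm_nonneg _) (fun n => ?_)
      (summable_one_div_succ_sq.mul_right (∫ t in Ioi (0 : ℝ), Real.exp (-a * t) * t ^ 2))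
    rw [← integral_const_mul]
    refine setIntegral_mono_on (integrableOn_exp_neg_mul_sub_log ha0 (hc n)).norm
      ((integrableOn_exp_neg_mul_mul_pow ha0 2).const_mul _) measurableSet_Ioi fun t ht => ?_
    rw [norm_mul, Real.norm_eq_abs, Real.norm_eq_abs, abs_of_pos (Real.exp_pos _), mul_left_comm]
    exact mul_le_mul_of_nonneg_left (abs_div_sub_log_le (hc n) ht) (Real.exp_pos _).le
  have hA := (hasSum_integral_of_summable_integral_norm
    (fun n : ℕ => integrableOn_exp_neg_mul_sub_log ha0 (hc n)) hs1).mul_left a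
  have hAB : ∀ n : ℕ, a * ∫ t in Ioi (0 : ℝ), Real.exp (-a * t) *
      (t / (n + 1) - Real.log (1 + t / (n + 1))) =
      ∫ s in Ioi (0 : ℝ), Real.exp (-(n + 1 : ℝ) * s) * (1 / a - 1 / (a + s)) := fun n => by
    rw [mul_integral_exp_neg_mul_sub_log ha0 (hc n),
      integral_exp_neg_mul_sub_div_add_comm ha0 (hc n)]
  -- All terms of both series are nonnegative, so summability of the norms passes from the first
  -- series to the second through the termwise identity.
  have hB := hasSum_integral_of_summable_integral_norm
    (fun n : ℕ => integrableOn_exp_neg_mul_sub_div_add (hc n) ha0)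
    (by simpa only [hJ, ← hAB, ← hI] using hs1.mul_left a)
  simp only [hAB] at hA
  have h := hA.unique hB
  have e1 : ∫ t in Ioi (0 : ℝ), ∑' n : ℕ, Real.exp (-a * t) *
      (t / (n + 1) - Real.log (1 + t / (n + 1))) = ∫ t in Ioi (0 : ℝ), Real.exp (-a * t) *
      (Real.log (Real.Gamma (1 + t)) + Real.eulerMascheroniConstant * t) :=
    setIntegral_congr_fun measurableSet_Ioi fun t ht =>
      ((hasSum_log_Gamma_one_add ht).mul_left _).tsum_eq
  have e2 : ∫ s in Ioi (0 : ℝ), ∑' n : ℕ, Real.exp (-(n + 1 : ℝ) * s) * (1 / a - 1 / (a + s)) =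
      ∫ s in Ioi (0 : ℝ), Real.exp (-s) * ((1 / a - 1 / (a + s)) / (1 - Real.exp (-s))) :=
    setIntegral_congr_fun measurableSet_Ioi fun s hs => (hasSum_exp_neg_mul hs _).tsum_eq
  rw [e1, e2] at h
  rw [h, integral_logKernel]

lemma integral_logKernel_eq {a : ℝ} (ha0 : 0 < a) :
    ∫ u in (0 : ℝ)..1, logKernel a u = Real.eulerMascheroniConstant / a +
      a * ∫ t in Ioi (0 : ℝ), Real.exp (-a * t) * Real.log (Real.Gamma (1 + t)) := by
  rw [← mul_integral_log_Gamma_add_eq_integral_logKernel ha0]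
  have e : ∀ t : ℝ, Real.exp (-a * t) *
      (Real.log (Real.Gamma (1 + t)) + Real.eulerMascheroniConstant * t) =
      Real.exp (-a * t) * Real.log (Real.Gamma (1 + t)) +
      Real.eulerMascheroniConstant * (Real.exp (-a * t) * t) := fun t => by ring
  have hi : IntegrableOn (fun t : ℝ => Real.exp (-a * t) * t) (Ioi 0) := by
    simpa using integrableOn_exp_neg_mul_mul_pow ha0 1
  simp only [e]
  rw [integral_add (integrableOn_exp_neg_mul_log_Gamma_one_add ha0) (hi.const_mul _),
    integral_const_mul, integral_exp_neg_mul_mul_self ha0]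
  field_simp
  ring

/-! ### The functional equation and reduction to `[0, 1]` -/

/-- Differentiating Euler's integral at `s = 1` gives `Γ'(1)`, whose value is `-γ`. -/
lemma integral_log_mul_exp_neg :
    ∫ t in Ioi (0 : ℝ), Real.log t * Real.exp (-t) = -Real.eulerMascheroniConstant := by
  have h1 := Complex.hasDerivAt_GammaIntegral (s := 1) (by simp)
  have h2 : Complex.Gamma =ᶠ[𝓝 1] Complex.GammaIntegral := by
    have : {s : ℂ | 0 < s.re} ∈ 𝓝 (1 : ℂ) :=
      (isOpen_lt continuous_const Complex.continuous_re).mem_nhds (by simp)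
    filter_upwards [this] with s hs using Complex.Gamma_eq_integral hs
  have h3 := (h1.congr_of_eventuallyEq h2).unique Complex.hasDerivAt_Gamma_one
  simp only [sub_self, Complex.cpow_zero, one_mul, ← Complex.ofReal_mul] at h3
  rw [integral_complex_ofReal, ← Complex.ofReal_neg] at h3
  exact Complex.ofReal_injective h3

/-- A non-integrable function has integral `0` by convention, whereas this integral is `-γ` and `γ >
1/2`. -/
lemma integrableOn_log_mul_exp_neg :
    IntegrableOn (fun t : ℝ => Real.log t * Real.exp (-t)) (Ioi 0) := by
  by_contra h
  have h1 := integral_undef h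
  rw [integral_log_mul_exp_neg] at h1
  have := Real.one_half_lt_eulerMascheroniConstant
  linarith

lemma exp_neg_mul_mul_log_eq {a t : ℝ} (ha0 : 0 < a) (ht : 0 < t) :
    Real.exp (-a * t) * Real.log t =
      Real.log (a * t) * Real.exp (-(a * t)) - Real.log a * Real.exp (-a * t) := by
  rw [Real.log_mul ha0.ne' ht.ne', neg_mul]
  ring

lemma integrableOn_exp_neg_mul_mul_log {a : ℝ} (ha0 : 0 < a) :
    IntegrableOn (fun t : ℝ => Real.exp (-a * t) * Real.log t) (Ioi 0) := by
  have h := (integrableOn_Ioi_comp_mul_left_iff (fun t : ℝ => Real.log t * Real.exp (-t)) 0 ha0).2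
    (by simpa using integrableOn_log_mul_exp_neg)
  exact (h.sub ((integrableOn_exp_neg_mul ha0).const_mul (Real.log a))).congr_fun
    (fun t ht => (exp_neg_mul_mul_log_eq ha0 ht).symm) measurableSet_Ioi

lemma integral_exp_neg_mul_mul_log {a : ℝ} (ha0 : 0 < a) :
    ∫ t in Ioi (0 : ℝ), Real.exp (-a * t) * Real.log t =
      -(Real.eulerMascheroniConstant + Real.log a) / a := by
  have h := (integrableOn_Ioi_comp_mul_left_iff (fun t : ℝ => Real.log t * Real.exp (-t)) 0 ha0).2
    (by simpa using integrableOn_log_mul_exp_neg)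
  rw [setIntegral_congr_fun measurableSet_Ioi fun t ht => exp_neg_mul_mul_log_eq ha0 ht,
    integral_sub h ((integrableOn_exp_neg_mul ha0).const_mul _),
    integral_comp_mul_left_Ioi (fun t : ℝ => Real.log t * Real.exp (-t)) 0 ha0, mul_zero,
    integral_log_mul_exp_neg, integral_const_mul, integral_exp_neg_mul ha0, smul_eq_mul]
  field_simp
  ring

lemma log_Gamma_eq {t : ℝ} (ht : 0 < t) :
    Real.log (Real.Gamma t) = Real.log (Real.Gamma (1 + t)) - Real.log t := by
  rw [add_comm, Real.Gamma_add_one ht.ne', Real.log_mul ht.ne' (Real.Gamma_pos_of_pos ht).ne']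
  ring

lemma integrableOn_exp_neg_mul_log_Gamma {a : ℝ} (ha0 : 0 < a) :
    IntegrableOn (fun t : ℝ => Real.exp (-a * t) * Real.log (Real.Gamma t)) (Ioi 0) := by
  refine ((integrableOn_exp_neg_mul_log_Gamma_one_add ha0).sub
    (integrableOn_exp_neg_mul_mul_log ha0)).congr_fun (fun t ht => ?_) measurableSet_Ioi
  rw [log_Gamma_eq ht, mul_sub]
  rfl

lemma intervalIntegrable_exp_neg_mul_log_Gamma {a : ℝ} (ha0 : 0 < a) :
    IntervalIntegrable (fun t : ℝ => Real.exp (-a * t) * Real.log (Real.Gamma t)) volume 0 1 := by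
  rw [intervalIntegrable_iff_integrableOn_Ioc_of_le zero_le_one]
  exact (integrableOn_exp_neg_mul_log_Gamma ha0).mono_set Ioc_subset_Ioi_self

/-- The effect of the functional equation of `Γ` on the Laplace transform of `log Γ`. -/
lemma integral_exp_neg_mul_log_Gamma_one_add {a : ℝ} (ha0 : 0 < a) :
    (1 - Real.exp (-a)) * ∫ t in Ioi (0 : ℝ), Real.exp (-a * t) * Real.log (Real.Gamma (1 + t)) =
      (∫ t in (0 : ℝ)..1, Real.exp (-a * t) * Real.log (Real.Gamma t)) -
        (Real.eulerMascheroniConstant + Real.log a) / a := by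
  have h1 : ∫ t in Ioi (0 : ℝ), Real.exp (-a * t) * Real.log (Real.Gamma t) =
      (∫ t in Ioi (0 : ℝ), Real.exp (-a * t) * Real.log (Real.Gamma (1 + t))) -
        ∫ t in Ioi (0 : ℝ), Real.exp (-a * t) * Real.log t := by
    rw [← integral_sub (integrableOn_exp_neg_mul_log_Gamma_one_add ha0)
      (integrableOn_exp_neg_mul_mul_log ha0)]
    refine setIntegral_congr_fun measurableSet_Ioi fun t ht => ?_
    rw [log_Gamma_eq ht, mul_sub]
  -- Translation by `1`: the tail of the transform of `log Γ` is `e^{-a}` times the full transform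
  -- of `log Γ(1 + t)`, which produces the factor `1 - e^{-a}`.
  have h2 : ∫ t in Ioi (1 : ℝ), Real.exp (-a * t) * Real.log (Real.Gamma t) =
      Real.exp (-a) * ∫ t in Ioi (0 : ℝ), Real.exp (-a * t) * Real.log (Real.Gamma (1 + t)) := by
    have := (measurePreserving_add_left volume (1 : ℝ)).setIntegral_preimage_emb
      (measurableEmbedding_addLeft 1)
      (fun t : ℝ => Real.exp (-a * t) * Real.log (Real.Gamma t)) (Ioi 1)
    rw [← this, ← integral_const_mul]
    simp only [preimage_const_add_Ioi, sub_self]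
    refine integral_congr_ae (ae_of_all _ fun t => ?_)
    beta_reduce
    rw [mul_add, mul_one, Real.exp_add, mul_assoc]
  have h3 := intervalIntegral.integral_interval_add_Ioi
    (integrableOn_exp_neg_mul_log_Gamma ha0)
    ((integrableOn_exp_neg_mul_log_Gamma ha0).mono_set (Ioi_subset_Ioi zero_le_one))
  rw [h2, h1, integral_exp_neg_mul_mul_log ha0] at h3
  rw [neg_div] at h3
  linarith

/-- Closed form of the Glasser–Manna–Oloa integral for `0 < a < ln 2`; both integrals converge. -/
theorem mainTheorem1 (a : ℝ) (ha0 : 0 < a) (ha : a < Real.log 2) :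
    IntervalIntegrable
      (fun x : ℝ => x ^ 2 / (x ^ 2 + Real.log (2 * Real.exp (-a) * Real.cos x) ^ 2))
      MeasureTheory.volume 0 (Real.pi / 2) ∧
    IntervalIntegrable (fun t : ℝ => Real.exp (-a * t) * Real.log (Real.Gamma t))
      MeasureTheory.volume 0 1 ∧
    glasserMannaOloaM a =
      Real.eulerMascheroniConstant / a
      + (a + Real.log (1 - Real.exp (-a)) - Real.eulerMascheroniConstant - Real.log a)
          / (1 - Real.exp (-a))
      + a / (1 - Real.exp (-a))
          * ∫ t in (0 : ℝ)..1, Real.exp (-a * t) * Real.log (Real.Gamma t) := by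
  refine ⟨intervalIntegrable_gmoIntegrand a _ _, intervalIntegrable_exp_neg_mul_log_Gamma ha0, ?_⟩
  rw [glasserMannaOloaM_eq ha0 ha, integral_logKernel_eq ha0]
  have h := integral_exp_neg_mul_log_Gamma_one_add ha0
  have hq : 1 - Real.exp (-a) ≠ 0 := by
    have := Real.exp_lt_one_iff.2 (neg_lt_zero.2 ha0)
    linarith
  rw [mul_comm, ← eq_div_iff hq] at h
  rw [h]
  field_simp
  ring
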